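/- Let $(\mathcal C,J)$ be an essentially small site. Let $a\dashv i:\mathrm{Sh}(\mathcal C,J)\hookrightarrow[\mathcal C^{op},\mathrm{Set}]$ be sheafification and inclusion, with unit $\eta$. For a morphism $f:P\to Q$ in a category with pullbacks, a dependent product $\prod_f$ along $f$ is a right adjoint of the pullback functor $f^*$ from objects over $Q$ to objects over $P$; it is unique up to isomorphism. For a presheaf $P$, let $\int P$ be its category of elements: objects are pairs $(X,p)$ with $p\in P(X)$, and arrows $(Y,p')\to(X,p)$ are the arrows $g:Y\to X$ with $P(g)(p)=p'$. Let $J_P$ be the Grothendieck topology on $\int P$ whose covering sieves are those whose image in $\mathcal C$ is a $J$-covering sieve. Let - $R_P:[\mathcal C^{op},\mathrm{Set}]/P\to[(\int P)^{op},\mathrm{Set}]$, $R_P[h](X,p)=h_X^{-1}(p)$; - $L_P:[(\int P)^{op},\mathrm{Set}]\to[\mathcal C^{op},\mathrm{Set}]/P$, $L_P(W)(X)=\bigsqcup_{p\in P(X)}W(X,p)$, with the projection to $P$; - $a_P:[\mathcal C^{op},\mathrm{Set}]/P\to\mathrm{Sh}(\mathcal C,J)/a(P)$, $[h]\mapsto[a(h)]$;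 - $i_P:\mathrm{Sh}(\mathcal C,J)/a(P)\to[\mathcal C^{op},\mathrm{Set}]/P$, pullback along $\eta_P:P\to a(P)$; - $R^J_P=R_P\circ i_P:\mathrm{Sh}(\mathcal C,J)/a(P)\to\mathrm{Sh}(\int P,J_P)$, and $L^J_P=a_P\circ L_P\circ (i_{J_P})_*:\mathrm{Sh}(\int P,J_P)\to\mathrm{Sh}(\mathcal C,J)/a(P)$, where $(i_{J_P})_*$ is the inclusion of sheaves into presheaves. A morphism $f:P\to Q$ of presheaves induces a comorphism of sites $\int f:(\int P,J_P)\to(\int Q,J_Q)$, $(X,p)\mapsto(X,f_X(p))$. Let $C(\int f)_*:\mathrm{Sh}(\int P,J_P)\to\mathrm{Sh}(\int Q,J_Q)$ be the direct image of the induced geometric morphism, i.e. the restriction to sheaves of the right Kan extension $\mathrm{ran}_{(\int f)^{op}}$. (1) For every morphism $f:P\to Q$ of presheaves, the dependent product $\prod_{a(f)}:\mathrm{Sh}(\mathcal C,J)/a(P)\to\mathrm{Sh}(\mathcal C,J)/a(Q)$ and the dependent product $\prod^{pr}_f:[\mathcal C^{op},\mathrm{Set}]/P\to[\mathcal C^{op},\mathrm{Set}]/Q$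 in presheaves exist, and there are isomorphisms of functors $$\textstyle\prod_{a(f)}\cong L^J_Q\circ C(\int f)_*\circ R^J_P\cong a_Q\circ L_Q\circ\mathrm{ran}_{(\int f)^{op}}\circ R_P\circ i_P\cong a_Q\circ\prod^{pr}_f\circ i_P .$$ (2) Let $f:P\to Q$ be a morphism of $J$-sheaves. Then $\prod_f:\mathrm{Sh}(\mathcal C,J)/P\to\mathrm{Sh}(\mathcal C,J)/Q$ exists and, for every $h:H\to P$ in $\mathrm{Sh}(\mathcal C,J)$ and every object $X$ of $\mathcal C$, there is a bijection $$\textstyle\prod_f[h](X)\cong\{(q,\underline x)\mid q\in Q(X),\ \underline x\in A_q\},$$ where $A_q$ is the set of families $\underline x=(x_{g,p})$ of elements $x_{g,p}\in h_Y^{-1}(p)$, indexed by the arrows $g:Y\to X$ and the elements $p\in P(Y)$ with $f_Y(p)=Q(g)(q)$, such that $H(\gamma)(x_{g,p})=x_{g\circ\gamma,P(\gamma)(p)}$ for all arrows $\gamma:Z\to Y$. The bijection is natural in $X$ and in $h$, and takes the structural morphism $\prod_f[h]\to Q$ to the projection $(q,\underline x)\mapsto q$. Moreover $\prod_f[h]$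 does not depend on $J$: its underlying presheaf over $Q$ is, naturally in $h$, the presheaf dependent product $\prod^{pr}_f[h]$. -/

import Mathlib

open CategoryTheory CategoryTheory.Limits Opposite

universe w v u

noncomputable section

namespace DepProd

section General

variable {E : Type u} [Category.{v} E] [HasPullbacks E]

/-- `F : E/P ⥤ E/Q` is a dependent product along `f : P ⟶ Q`:
it is right adjoint to the pullback functor `f^* : E/Q ⥤ E/P`. -/
def IsDependentProduct {P Q : E} (f : P ⟶ Q) (F : Over P ⥤ Over Q) : Prop :=
  Nonempty (Over.pullback f ⊣ F)

end General

variable {C : Type u} [Category.{v} C]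

/-! ### The category of elements and its topology -/

/-- The category of elements `∫ P` of a presheaf `P`: objects are pairs `(X, x)` with `x ∈ P(X)`,
and morphisms `(Y, y) ⟶ (X, x)` are the arrows `g : Y ⟶ X` with `P(g)(x) = y`. -/
abbrev Elts (P : Cᵒᵖ ⥤ Type w) := P.Elementsᵒᵖ

variable {P Q : Cᵒᵖ ⥤ Type w}

/-- The object `(X, x)` of `∫ P`. -/
abbrev Elts.mk {X : Cᵒᵖ} (x : P.obj X) : Elts P := op ⟨X, x⟩

/-- The morphism `(Y, y) ⟶ (X, x)` of `∫ P` given by `g : Y ⟶ X` with `P(g)(x) = y`. -/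
abbrev Elts.homMk {X Y : Cᵒᵖ} (g : X ⟶ Y) (x : P.obj X) (y : P.obj Y) (h : P.map g x = y) :
    Elts.mk y ⟶ Elts.mk x :=
  Quiver.Hom.op (V := P.Elements) (X := ⟨X, x⟩) (Y := ⟨Y, y⟩) ⟨g, h⟩

/-- The projection `π_P : ∫ P ⥤ C`, `(X, x) ↦ X`. -/
abbrev proj (P : Cᵒᵖ ⥤ Type w) : Elts P ⥤ C := (CategoryOfElements.π P).leftOp

/-- The functor `∫ f : ∫ P ⥤ ∫ Q`, `(X, p) ↦ (X, f_X(p))`. -/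
abbrev eltsMap (f : P ⟶ Q) : Elts P ⥤ Elts Q := (CategoryOfElements.map f).op

/-- A sieve `S` on `(X, x)` contains a unique lift of each arrow in its image under `π_P`. -/
lemma mem_push_iff {X : Cᵒᵖ} {x : P.obj X} (S : Sieve (Elts.mk x)) {Y : C} (g : Y ⟶ X.unop) :
    S.functorPushforward (proj P) g ↔ S (Elts.homMk (P := P) g.op x (P.map g.op x) rfl) := by
  constructor
  · rintro ⟨⟨⟨Z, z⟩⟩, ⟨⟨k, hk2⟩⟩, l, hk, rfl⟩
    change P.map k x = z at hk2
    have h2 : P.map l.op z = P.map (k ≫ l.op) x := by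
      rw [← hk2]; exact (Functor.map_comp_apply P k l.op x).symm
    exact S.downward_closed hk (Elts.homMk (P := P) l.op z _ h2)
  · intro h
    exact ⟨_, _, 𝟙 _, h, (Category.id_comp g).symm⟩

/-- The Grothendieck topology `J_P` on `∫ P`: a sieve is covering if and only if its image under
`π_P` is a `J`-covering sieve. -/
def eltsTopology (J : GrothendieckTopology C) (P : Cᵒᵖ ⥤ Type w) :
    GrothendieckTopology (Elts P) where
  sieves e := {S | S.functorPushforward (proj P) ∈ J ((proj P).obj e)}
  top_mem' e := by simp
  pullback_stable' := by
    rintro ⟨⟨X, x⟩⟩ ⟨⟨X', x'⟩⟩ S ⟨⟨(k : X ⟶ X'), (hk : P.map k x = x')⟩⟩ hS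
    subst hk
    refine J.superset_covering ?_ (J.pullback_stable k.unop hS)
    intro Y g hg
    refine (mem_push_iff _ g).2 ?_
    have hg' := (mem_push_iff S (g ≫ k.unop)).1 hg
    have h2 : P.map (k ≫ g.op) x = P.map g.op (P.map k x) := Functor.map_comp_apply P k g.op x
    have h3 := S.downward_closed hg' (Elts.homMk (P := P) (𝟙 _)
      (P.map (k ≫ g.op) x) (P.map g.op (P.map k x))
      ((Functor.map_id_apply P _ _).trans h2))
    refine Eq.mpr (congrArg (fun t => S.arrows t) ?_) h3
    exact Quiver.Hom.unop_inj (Subtype.ext (Category.comp_id (k ≫ g.op)).symm)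
  transitive' := by
    rintro ⟨⟨X, x⟩⟩ S hS R h
    refine J.transitive hS _ ?_
    rintro Y g hg
    have hg' := (mem_push_iff S g).1 hg
    refine J.superset_covering ?_ (h hg')
    rintro Z k ⟨W, a, b, ha, rfl⟩
    exact ⟨W, a ≫ Elts.homMk (P := P) g.op x _ rfl, b, ha, Category.assoc _ _ _⟩

lemma mem_eltsTopology_iff (J : GrothendieckTopology C) {e : Elts P} (S : Sieve e) :
    S ∈ eltsTopology J P e ↔ S.functorPushforward (proj P) ∈ J ((proj P).obj e) := Iff.rfl

/-- `∫ f` is a comorphism of sites (it has the covering-lifting property). -/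
instance eltsMap_isCocontinuous (J : GrothendieckTopology C) (f : P ⟶ Q) :
    (eltsMap f).IsCocontinuous (eltsTopology J P) (eltsTopology J Q) where
  cover_lift := by
    rintro ⟨⟨X, x⟩⟩ S hS
    rw [mem_eltsTopology_iff] at hS ⊢
    refine J.superset_covering ?_ hS
    intro Y g hg
    refine (mem_push_iff _ g).2 ?_
    have hg' := (mem_push_iff (P := Q) (x := f.app X x) S g).1 hg
    have h2 : Q.map g.op (f.app X x) = f.app _ (P.map g.op x) :=
      (NatTrans.naturality_apply f g.op x).symm
    have h3 := S.downward_closed hg' (Elts.homMk (P := Q) (𝟙 _) _ (f.app _ (P.map g.op x))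
      ((Functor.map_id_apply Q _ _).trans h2))
    refine Eq.mpr (congrArg (fun t => S.arrows t) ?_) h3
    exact Quiver.Hom.unop_inj (Subtype.ext (Category.comp_id g.op).symm)

/-! ### The functors `R` and `L` for presheaves -/

/-- The presheaf `(X, p) ↦ h_X⁻¹(p)` on `∫ P` attached to `h : H ⟶ P`. -/
def fiberPresheaf (h : Over P) : (Elts P)ᵒᵖ ⥤ Type w where
  obj e := {x : h.left.obj e.unop.unop.1 // h.hom.app e.unop.unop.1 x = e.unop.unop.2}
  map {e e'} g := ↾fun x => ⟨h.left.map g.unop.unop.val x.1,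
    ((NatTrans.naturality_apply h.hom g.unop.unop.val x.1).trans
      (congrArg (P.map g.unop.unop.val) x.2)).trans g.unop.unop.2⟩
  map_id e := by
    refine ConcreteCategory.hom_ext _ _ fun x => ?_
    exact Subtype.ext (Functor.map_id_apply h.left _ _)
  map_comp {e e' e''} g g' := by
    refine ConcreteCategory.hom_ext _ _ fun x => ?_
    exact Subtype.ext (Functor.map_comp_apply h.left _ _ _)

variable (P) in
/-- `R_P : [Cᵒᵖ, Set]/P ⥤ [(∫ P)ᵒᵖ, Set]`, `R_P[h](X, p) = h_X⁻¹(p)`. -/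
def R : Over P ⥤ ((Elts P)ᵒᵖ ⥤ Type w) where
  obj h := fiberPresheaf h
  map {h h'} φ :=
    { app e := ↾fun x => ⟨φ.left.app e.unop.unop.1 x.1,
        (ConcreteCategory.congr_hom (NatTrans.congr_app (Over.w φ) e.unop.unop.1) x.1).trans x.2⟩
      naturality e e' g := by
        refine ConcreteCategory.hom_ext _ _ fun x => ?_
        have := NatTrans.naturality_apply φ.left g.unop.unop.val (Subtype.val x)
        exact Subtype.ext this }
  map_id h := rfl
  map_comp φ ψ := rfl

lemma sigma_ext {W : (Elts P)ᵒᵖ ⥤ Type w} {X Y : Cᵒᵖ} {x : P.obj X} (a : W.obj (op (Elts.mk x)))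
    {g g' : X ⟶ Y} (hg : g = g') {y y' : P.obj Y} (hy : P.map g x = y) (hy' : P.map g' x = y') :
    (⟨y, W.map (Elts.homMk g x y hy).op a⟩ : Σ p : P.obj Y, W.obj (op (Elts.mk p))) =
      ⟨y', W.map (Elts.homMk g' x y' hy').op a⟩ := by
  subst hg hy hy'
  rfl

variable (P) in
/-- `L_P : [(∫ P)ᵒᵖ, Set] ⥤ [Cᵒᵖ, Set]/P`, `L_P(W)(X) = ⨆_{p ∈ P(X)} W(X, p)` (disjoint union),
with structural morphism `(p, a) ↦ p`. -/
def L : ((Elts P)ᵒᵖ ⥤ Type w) ⥤ Over P where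
  obj W := Over.mk (Y :=
    { obj X := Σ p : P.obj X, W.obj (op (Elts.mk p))
      map {X Y} g := ↾fun a => ⟨P.map g a.1, W.map (Elts.homMk g a.1 _ rfl).op a.2⟩
      map_id X := by
        refine ConcreteCategory.hom_ext _ _ fun ⟨p, a⟩ => ?_
        refine (sigma_ext (W := W) a rfl rfl (Functor.map_id_apply P X p)).trans ?_
        exact congrArg (Sigma.mk p) (Functor.map_id_apply W _ a)
      map_comp {X Y Z} g g' := by
        refine ConcreteCategory.hom_ext _ _ fun ⟨p, a⟩ => ?_
        refine (sigma_ext (W := W) a rfl rfl (Functor.map_comp_apply P g g' p)).trans ?_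
        exact congrArg (Sigma.mk _) (Functor.map_comp_apply W (Elts.homMk g p _ rfl).op
          (Elts.homMk g' (P.map g p) _ rfl).op a) })
    { app X := ↾fun a => a.1
      naturality X Y g := rfl }
  map {W W'} φ := Over.homMk
    { app X := ↾fun a => ⟨a.1, φ.app _ a.2⟩
      naturality X Y g := by
        refine ConcreteCategory.hom_ext _ _ fun ⟨p, a⟩ => ?_
        exact congrArg (Sigma.mk _) (NatTrans.naturality_apply φ _ a) } rfl
  map_id W := rfl
  map_comp φ ψ := rfl

/-! ### Sheaves on an essentially small site -/

section Sheaf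

instance hasSheafify_type (J : GrothendieckTopology C) [EssentiallySmall.{w} C] :
    HasSheafify J (Type w) :=
  hasSheafifyEssentiallySmallSite J (Type w)

/-- The right Kan extensions along `(∫ f)ᵒᵖ` exist, since `∫ P` is essentially small. -/
instance hasPointwiseRan [EssentiallySmall.{w} C] (f : P ⟶ Q) (W : (Elts P)ᵒᵖ ⥤ Type w) :
    (eltsMap f).op.HasPointwiseRightKanExtension W := by
  intro Y
  have : HasLimitsOfShape (StructuredArrow Y (eltsMap f).op) (Type w) :=
    hasLimitsOfShape_of_essentiallySmall _ _
  infer_instance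

variable (J : GrothendieckTopology C)

lemma fiberPresheaf_isSheaf {h : Over P} {W S : Sheaf J (Type w)} (k : W.obj ⟶ S.obj)
    (a : h.left ⟶ W.obj) (η : P ⟶ S.obj) (sq : IsPullback a h.hom k η) :
    Presheaf.IsSheaf (eltsTopology J P) (fiberPresheaf h) := by
  have sqX (X : Cᵒᵖ) := sq.map ((evaluation Cᵒᵖ (Type w)).obj X)
  have hW := (isSheaf_iff_isSheaf_of_type J W.obj).1 W.property
  have hS := (isSheaf_iff_isSheaf_of_type J S.obj).1 S.property
  rw [isSheaf_iff_isSheaf_of_type]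
  rintro ⟨⟨X, p⟩⟩ T hT x hx
  rw [mem_eltsTopology_iff] at hT
  have hx' {Y Z : C} {g₁ : Y ⟶ X.unop} (h₁ : T (Elts.homMk (P := P) g₁.op p _ rfl)) (k₁ : Z ⟶ Y)
      {g₂ : Z ⟶ X.unop} (h₂ : T (Elts.homMk (P := P) g₂.op p _ rfl)) (e : k₁ ≫ g₁ = g₂) :
      h.left.map k₁.op (x _ h₁).1 = (x _ h₂).1 := by
    subst e
    have hp : P.map k₁.op (P.map g₁.op p) = P.map (k₁ ≫ g₁).op p :=
      (Functor.map_comp_apply P g₁.op k₁.op p).symm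
    have := hx (Elts.homMk (P := P) k₁.op _ _ hp) (𝟙 _) h₁ h₂
      (Quiver.Hom.unop_inj (Subtype.ext (Category.comp_id (g₁.op ≫ k₁.op)).symm))
    exact (congrArg Subtype.val this).trans (Functor.map_id_apply h.left _ _)
  let y : Presieve.FamilyOfElements W.obj (T.functorPushforward (proj P)).arrows :=
    fun Y g hg => a.app (op Y) (x _ ((mem_push_iff T g).1 hg)).1
  have hy : y.Compatible := by
    intro Y₁ Y₂ Z g₁ g₂ f₁ f₂ h₁ h₂ comm
    have h₃ := (T.functorPushforward (proj P)).downward_closed h₁ g₁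
    have e₁ := hx' ((mem_push_iff T f₁).1 h₁) g₁ ((mem_push_iff T _).1 h₃) rfl
    have e₂ := hx' ((mem_push_iff T f₂).1 h₂) g₂ ((mem_push_iff T _).1 h₃) comm.symm
    calc W.obj.map g₁.op (y f₁ h₁) = a.app _ (h.left.map g₁.op _) :=
          (NatTrans.naturality_apply a g₁.op _).symm
      _ = a.app _ (h.left.map g₂.op _) := congrArg _ (e₁.trans e₂.symm)
      _ = W.obj.map g₂.op (y f₂ h₂) := NatTrans.naturality_apply a g₂.op _
  obtain ⟨t, ht, htu⟩ := hW _ hT y hy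
  have hkt : k.app X t = η.app X p := by
    refine (hS _ hT).isSeparatedFor.ext fun Y g hg => ?_
    have e₁ : k.app _ (y g hg) = η.app _ (P.map g.op p) :=
      (ConcreteCategory.congr_hom (sqX (op Y)).w _).trans
        (congrArg (η.app (op Y)) (x _ ((mem_push_iff T g).1 hg)).2)
    calc S.obj.map g.op (k.app X t) = k.app _ (W.obj.map g.op t) :=
          (NatTrans.naturality_apply k g.op t).symm
      _ = k.app _ (y g hg) := congrArg _ (ht g hg)
      _ = η.app _ (P.map g.op p) := e₁
      _ = S.obj.map g.op (η.app X p) := NatTrans.naturality_apply η g.op p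
  obtain ⟨z, hz₁, hz₂⟩ := Types.exists_of_isPullback (sqX X) t p hkt
  refine ⟨⟨z, hz₂⟩, ?_, ?_⟩
  · rintro ⟨⟨Y, q⟩⟩ ⟨⟨(g : X ⟶ Y), (hg : P.map g p = q)⟩⟩ hgT
    subst hg
    refine Subtype.ext (Types.ext_of_isPullback (sqX Y) ?_ ?_)
    · have hm : T.functorPushforward (proj P) g.unop := (mem_push_iff T g.unop).2 hgT
      exact ((NatTrans.naturality_apply a g z).trans (congrArg (W.obj.map g) hz₁)).trans
        (ht g.unop hm)
    · exact ((NatTrans.naturality_apply h.hom g z).trans (congrArg (P.map g) hz₂)).trans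
        (x _ hgT).2.symm
  · rintro ⟨z', hz'⟩ hz'T
    refine Subtype.ext (Types.ext_of_isPullback (sqX X) ?_ (hz'.trans hz₂.symm))
    refine (htu _ ?_).trans hz₁.symm
    intro Y g hg
    exact (NatTrans.naturality_apply a g.op z').symm.trans
      (congrArg (fun r => a.app (op Y) (Subtype.val r)) (hz'T _ ((mem_push_iff T g).1 hg)))

variable [EssentiallySmall.{w} C]

/-- The direct image `C(∫ f)_* : Sh(∫ P, J_P) ⥤ Sh(∫ Q, J_Q)` of the geometric morphism induced
by the comorphism of sites `∫ f`: the restriction to sheaves of the right Kan extension along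
`(∫ f)ᵒᵖ`. -/
def directImage (f : P ⟶ Q) :
    Sheaf (eltsTopology J P) (Type w) ⥤ Sheaf (eltsTopology J Q) (Type w) :=
  (eltsMap f).sheafPushforwardCocontinuous (Type w) (eltsTopology J P) (eltsTopology J Q)

/-- `a_P : [Cᵒᵖ, Set]/P ⥤ Sh(C, J)/a(P)`, `[h] ↦ [a(h)]`. -/
def sliceSheafify (P : Cᵒᵖ ⥤ Type w) : Over P ⥤ Over ((presheafToSheaf J (Type w)).obj P) :=
  Over.post (presheafToSheaf J (Type w))

/-- `i_P : Sh(C, J)/a(P) ⥤ [Cᵒᵖ, Set]/P`, the pullback along the unit `η_P : P ⟶ i(a(P))` of the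
underlying morphism of presheaves. -/
def sliceInclusion (P : Cᵒᵖ ⥤ Type w) : Over ((presheafToSheaf J (Type w)).obj P) ⥤ Over P :=
  Over.post (sheafToPresheaf J (Type w)) ⋙
    Over.pullback ((sheafificationAdjunction J (Type w)).unit.app P)

/-- `R^J_P : Sh(C, J)/a(P) ⥤ Sh(∫ P, J_P)`, acting as `R_P ∘ i_P`. -/
def RSheaf (P : Cᵒᵖ ⥤ Type w) :
    Over ((presheafToSheaf J (Type w)).obj P) ⥤ Sheaf (eltsTopology J P) (Type w) :=
  ObjectProperty.lift _ (sliceInclusion J P ⋙ R P) fun k =>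
    fiberPresheaf_isSheaf J (W := k.left) (S := (presheafToSheaf J (Type w)).obj P)
      k.hom.hom (pullback.fst k.hom.hom ((sheafificationAdjunction J (Type w)).unit.app P))
      ((sheafificationAdjunction J (Type w)).unit.app P) (IsPullback.of_hasPullback _ _)

/-- `L^J_P : Sh(∫ P, J_P) ⥤ Sh(C, J)/a(P)`, `L^J_P = a_P ∘ L_P ∘ (i_{J_P})_*`. -/
def LSheaf (P : Cᵒᵖ ⥤ Type w) :
    Sheaf (eltsTopology J P) (Type w) ⥤ Over ((presheafToSheaf J (Type w)).obj P) :=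
  sheafToPresheaf _ _ ⋙ L P ⋙ sliceSheafify J P

end Sheaf

/-! ### The explicit description -/

/-- The set of pairs `(q, x)` with `q ∈ Q(X)` and `x` a family of elements `x_{g,p} ∈ h_Y⁻¹(p)`
indexed by the arrows `g : Y ⟶ X` and the `p ∈ P(Y)` with `f_Y(p) = Q(g)(q)`, such that
`H(γ)(x_{g,p}) = x_{g ∘ γ, P(γ)(p)}` for all `γ` with codomain `Y`. -/
@[ext]
structure CompatiblePair (f : P ⟶ Q) (h : Over P) (X : Cᵒᵖ) where
  base : Q.obj X
  fam : ∀ (Y : C) (g : Y ⟶ X.unop) (p : P.obj (op Y)), f.app (op Y) p = Q.map g.op base →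
    {x : h.left.obj (op Y) // h.hom.app (op Y) x = p}
  compat : ∀ (Y Z : C) (g : Y ⟶ X.unop) (γ : Z ⟶ Y) (p : P.obj (op Y))
    (hp : f.app (op Y) p = Q.map g.op base)
    (hp' : f.app (op Z) (P.map γ.op p) = Q.map (γ ≫ g).op base),
    h.left.map γ.op (fam Y g p hp).1 = (fam Z (γ ≫ g) (P.map γ.op p) hp').1

/-- The action of arrows of `C` on compatible pairs: `(q, x) ↦ (Q(k)(q), (x_{k ∘ g, p})_{g,p})`. -/
def CompatiblePair.restrict {f : P ⟶ Q} {h : Over P} {X X' : Cᵒᵖ} (k : X ⟶ X')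
    (s : CompatiblePair f h X) : CompatiblePair f h X' where
  base := Q.map k s.base
  fam Y g p hp := s.fam Y (g ≫ k.unop) p
    (hp.trans (Functor.map_comp_apply Q k g.op s.base).symm)
  compat Y Z g γ p hp hp' := by
    have hp'' : f.app (op Z) (P.map γ.op p) = Q.map (γ ≫ g ≫ k.unop).op s.base := by
      refine hp'.trans (Functor.map_comp_apply Q k (γ ≫ g).op s.base).symm |>.trans ?_
      rw [← Category.assoc]; rfl
    refine (s.compat Y Z (g ≫ k.unop) γ p _ hp'').trans ?_
    congr 2
    simp

/-- The action on compatible pairs of a morphism `φ : [h] ⟶ [h']` over `P`: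
`(q, x) ↦ (q, (φ_Y(x_{g,p}))_{g,p})`. -/
def CompatiblePair.map {f : P ⟶ Q} {h h' : Over P} (φ : h ⟶ h') {X : Cᵒᵖ}
    (s : CompatiblePair f h X) : CompatiblePair f h' X where
  base := s.base
  fam Y g p hp := ⟨φ.left.app (op Y) (s.fam Y g p hp).1,
    (ConcreteCategory.congr_hom (NatTrans.congr_app (Over.w φ) (op Y)) _).trans
      (s.fam Y g p hp).2⟩
  compat Y Z g γ p hp hp' :=
    (NatTrans.naturality_apply φ.left γ.op _).symm.trans
      (congrArg (φ.left.app (op Z)) (s.compat Y Z g γ p hp hp'))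

end DepProd

end

/-! For presheaves, `R P` and `L P` are mutually inverse equivalences. Through them, pullback along
`f` becomes precomposition with `∫ f` (`pullbackCompRIso`), whose right adjoint is the right Kan
extension. Hence `L_Q ∘ ran ∘ R_P` is right adjoint to pullback (`ranProdAdjunction`).

For sheaves, `i_P` is fully faithful with left adjoint `a_P`, and the inclusions commute with
pullback. The presheaf adjunction therefore restricts as soon as `ranProd f` sends the image of
`i_P` into the essential image of `i_Q`. The key criterion is `isIso_sliceAdjunction_unit`: an
object over `P` lies in that image when its fibre presheaf is a `J_P`-sheaf. Indeed the unit is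
locally bijective, `R P` preserves this, and a locally bijective map of sheaves is invertible. The
criterion applies because `∫ f` is a comorphism of sites, so `ran` preserves sheaves
(`R_ranProd_isSheaf`).

If `P` and `Q` are sheaves, the same criterion shows that the presheaf product is already a sheaf
(`isSheaf_left`), so sheafification plays no role. The pointwise limit formula for `ran` then yields
the compatible families. Uniqueness of right adjoints transfers everything to an arbitrary dependent
product. -/

noncomputable section

namespace DepProd

/-! ### Dependent products of presheaves via categories of elements -/

section

variable {C : Type u} [Category.{v} C] {P Q : Cᵒᵖ ⥤ Type w}

/-- `R_P ∘ L_P` is isomorphic to the identity. -/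
def isoRL (P : Cᵒᵖ ⥤ Type w) : L P ⋙ R P ≅ 𝟭 ((Elts P)ᵒᵖ ⥤ Type w) :=
  NatIso.ofComponents (fun W => NatIso.ofComponents (fun e => Equiv.toIso
    -- The base point of `x` equals that of `e` only propositionally, so the value is transported
    -- along an arrow lying over an identity of `C`.
    { toFun := fun x => W.map (Elts.homMk (P := P) (𝟙 _) x.1.1 e.unop.unop.2
        ((Functor.map_id_apply P _ _).trans x.2)).op x.1.2
      invFun := fun a => ⟨⟨e.unop.unop.2, a⟩, rfl⟩
      left_inv := by
        rintro ⟨⟨p, a⟩, hp⟩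
        obtain ⟨⟨X, q⟩⟩ := e
        cases hp
        exact Subtype.ext (congrArg (Sigma.mk _) (Functor.map_id_apply W _ a))
      right_inv := fun a => Functor.map_id_apply W _ a })
    (by
      rintro e e' g
      refine ConcreteCategory.hom_ext _ _ fun x => ?_
      obtain ⟨⟨p, a⟩, hp⟩ := x
      refine (Functor.map_comp_apply W _ _ a).symm.trans
        (Eq.trans ?_ (Functor.map_comp_apply W _ _ a))
      refine congrArg (fun k => W.map k a) ?_
      refine Quiver.Hom.unop_inj (Quiver.Hom.unop_inj (Subtype.ext ?_))
      exact (Category.comp_id _).trans (Category.id_comp _).symm))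
    (by
      intro W W' φ
      refine NatTrans.ext (funext fun e => ConcreteCategory.hom_ext _ _ fun x => ?_)
      exact (NatTrans.naturality_apply φ _ _).symm)

lemma sigma_fiber_ext {H : Cᵒᵖ ⥤ Type w} (h : H ⟶ P) {X : Cᵒᵖ} {p q : P.obj X} (hpq : p = q)
    (x : H.obj X) (hp : h.app X x = p) (hq : h.app X x = q) :
    (⟨p, ⟨x, hp⟩⟩ : Σ p : P.obj X, {x : H.obj X // h.app X x = p}) = ⟨q, ⟨x, hq⟩⟩ := by
  cases hpq
  rfl

/-- `L_P ∘ R_P` is isomorphic to the identity. -/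
def isoLR (P : Cᵒᵖ ⥤ Type w) : 𝟭 (Over P) ≅ R P ⋙ L P :=
  NatIso.ofComponents (fun h => Over.isoMk (NatIso.ofComponents (fun X => Equiv.toIso
    { toFun := fun x => ⟨h.hom.app X x, ⟨x, rfl⟩⟩
      invFun := fun y => y.2.1
      left_inv := fun _ => rfl
      right_inv := by
        rintro ⟨p, ⟨x, hx⟩⟩
        exact sigma_fiber_ext h.hom hx x rfl hx })
    (by
      intro X Y g
      refine ConcreteCategory.hom_ext _ _ fun x => ?_
      exact sigma_fiber_ext h.hom (NatTrans.naturality_apply h.hom g x) _ _ _)) rfl)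
    (by
      intro h h' φ
      refine Over.OverMorphism.ext (NatTrans.ext (funext fun X =>
        ConcreteCategory.hom_ext _ _ fun x => ?_))
      exact sigma_fiber_ext h'.hom (ConcreteCategory.congr_hom (NatTrans.congr_app (Over.w φ) X) x) _ _ _)

/-- Presheaves over `P` are equivalent to presheaves on `∫ P`. -/
def overEquivElts (P : Cᵒᵖ ⥤ Type w) : Over P ≌ ((Elts P)ᵒᵖ ⥤ Type w) :=
  CategoryTheory.Equivalence.mk (R P) (L P) (isoLR P) (isoRL P)

/-- Under `R`, pullback along `f` becomes precomposition with `∫ f`. -/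
def pullbackCompRIso (f : P ⟶ Q) :
    Over.pullback f ⋙ R P ≅
      R Q ⋙ (Functor.whiskeringLeft _ _ (Type w)).obj (eltsMap f).op :=
  NatIso.ofComponents (fun h => NatIso.ofComponents (fun e => Equiv.toIso (Equiv.ofBijective
    (fun x => ⟨(pullback.fst h.hom f).app _ x.1,
        (ConcreteCategory.congr_hom (NatTrans.congr_app (pullback.condition (f := h.hom) (g := f))
          e.unop.unop.1) x.1).trans (congrArg (fun p => f.app e.unop.unop.1 p) x.2)⟩)
      (by
        -- Pullbacks of presheaves are computed pointwise, so the fibre of the pullback over `p` is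
        -- the fibre of `h` over `f(p)`.
        have sq := (IsPullback.of_hasPullback h.hom f).map
          ((evaluation Cᵒᵖ (Type w)).obj e.unop.unop.1)
        constructor
        · rintro ⟨x, hx⟩ ⟨y, hy⟩ hxy
          exact Subtype.ext (Types.ext_of_isPullback sq (congrArg Subtype.val hxy)
            (hx.trans hy.symm))
        · rintro ⟨y, hy⟩
          obtain ⟨x, hx, hx'⟩ := Types.exists_of_isPullback sq y e.unop.unop.2 hy
          exact ⟨⟨x, hx'⟩, Subtype.ext hx⟩)))
    (by
      intro e e' g
      refine ConcreteCategory.hom_ext _ _ fun x => Subtype.ext ?_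
      exact NatTrans.naturality_apply (pullback.fst h.hom f) g.unop.unop.val x.1))
    (by
      intro h h' φ
      refine NatTrans.ext (funext fun e => ConcreteCategory.hom_ext _ _ fun x => Subtype.ext ?_)
      have : ((Over.pullback f).map φ).left ≫ pullback.fst h'.hom f =
        pullback.fst h.hom f ≫ φ.left := pullback.lift_fst _ _ _
      exact ConcreteCategory.congr_hom (NatTrans.congr_app this e.unop.unop.1) x.1)

/-- The dependent product of presheaves along `f`, as `L_Q ∘ ran_{(∫ f)ᵒᵖ} ∘ R_P`. -/
abbrev ranProd [EssentiallySmall.{w} C] (f : P ⟶ Q) : Over P ⥤ Over Q :=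
  R P ⋙ (eltsMap f).op.ran ⋙ L Q

/-- `L_Q ∘ ran_{(∫ f)ᵒᵖ} ∘ R_P` is right adjoint to the pullback functor along `f`. -/
def ranProdAdjunction [EssentiallySmall.{w} C] (f : P ⟶ Q) : Over.pullback f ⊣ ranProd f :=
  (((overEquivElts Q).toAdjunction.comp ((eltsMap f).op.ranAdjunction (Type w))).comp
    (overEquivElts P).symm.toAdjunction).ofNatIsoLeft
      (show (R Q ⋙ (Functor.whiskeringLeft _ _ (Type w)).obj (eltsMap f).op) ⋙ L P ≅ _ from
        (Functor.isoWhiskerRight (pullbackCompRIso f) (L P)).symm ≪≫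
          Functor.isoWhiskerLeft (Over.pullback f) (isoLR P).symm)

end

/-! ### Restriction of the dependent product to slices of sheaves -/

section

variable {C : Type u} [Category.{v} C] {P Q : Cᵒᵖ ⥤ Type w}

/-- A sieve on `(U, q)` covers when its image in `C` does, and each arrow of `C` into `U` lifts
uniquely to `(U, q)`. The local equalities for `φ.left` are thus the ones needed on `∫ Q`. -/
lemma R_map_isLocallyInjective (J : GrothendieckTopology C) {X Y : Over Q} (φ : X ⟶ Y)
    [Presheaf.IsLocallyInjective J φ.left] :
    Presheaf.IsLocallyInjective (eltsTopology J Q) ((R Q).map φ) where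
  equalizerSieve_mem := by
    rintro ⟨⟨⟨U, q⟩⟩⟩ x y hxy
    have hxy' : φ.left.app U x.1 = φ.left.app U y.1 := congrArg Subtype.val hxy
    refine J.superset_covering ?_ (Presheaf.equalizerSieve_mem J φ.left (X := U) x.1 y.1 hxy')
    intro V g hg
    exact (mem_push_iff _ g).2 (Subtype.ext hg)

lemma R_map_isLocallySurjective (J : GrothendieckTopology C) {X Y : Over Q} (φ : X ⟶ Y)
    [Presheaf.IsLocallySurjective J φ.left] :
    Presheaf.IsLocallySurjective (eltsTopology J Q) ((R Q).map φ) where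
  imageSieve_mem := by
    rintro ⟨⟨U, q⟩⟩ y
    refine J.superset_covering ?_ (Presheaf.imageSieve_mem J φ.left (U := U) y.1)
    rintro V g ⟨x, hx⟩
    refine (mem_push_iff _ g).2 ⟨⟨x, ?_⟩, Subtype.ext hx⟩
    -- A local preimage automatically lies in the fibre over the restriction of `q`, since `φ` is a
    -- morphism over `Q`.
    calc X.hom.app (op V) x = Y.hom.app (op V) (φ.left.app (op V) x) :=
          (ConcreteCategory.congr_hom (NatTrans.congr_app (Over.w φ) (op V)) x).symm
      _ = Y.hom.app (op V) (Y.left.map g.op y.1) := congrArg _ hx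
      _ = Q.map g.op (Y.hom.app U y.1) := NatTrans.naturality_apply Y.hom g.op y.1
      _ = Q.map g.op q := congrArg (Q.map g.op) y.2

instance wEqualsLocallyBijective_type [EssentiallySmall.{w} C] (J : GrothendieckTopology C) :
    J.WEqualsLocallyBijective (Type w) :=
  have (X : Cᵒᵖ) : HasLimitsOfShape (StructuredArrow X (equivSmallModel.{w} C).inverse.op)
      (Type w) := hasLimitsOfShape_of_essentiallySmall _ _
  GrothendieckTopology.WEqualsLocallyBijective.ofEssentiallySmall J

variable [EssentiallySmall.{w} C] (J : GrothendieckTopology C)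

/-- A morphism over `Q` that becomes invertible after sheafification is invertible if its source
and target correspond to sheaves on `∫ Q`. -/
lemma isIso_of_W {X Y : Over Q} (φ : X ⟶ Y) (hφ : J.W φ.left)
    (hX : Presheaf.IsSheaf (eltsTopology J Q) ((R Q).obj X))
    (hY : Presheaf.IsSheaf (eltsTopology J Q) ((R Q).obj Y)) : IsIso φ := by
  have := hφ.isLocallyInjective
  have := hφ.isLocallySurjective
  let ψ : (⟨(R Q).obj X, hX⟩ : Sheaf (eltsTopology J Q) (Type w)) ⟶ ⟨(R Q).obj Y, hY⟩ :=
    ⟨(R Q).map φ⟩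
  have h₁ : Sheaf.IsLocallyInjective ψ := R_map_isLocallyInjective J φ
  have h₂ : Sheaf.IsLocallySurjective ψ := R_map_isLocallySurjective J φ
  -- The sheaf hypotheses enter here: between sheaves on `∫ Q`, locally bijective means invertible.
  -- The equivalence `R Q` then reflects this.
  have : IsIso ψ := (Sheaf.isLocallyBijective_iff_isIso ψ).1 ⟨h₁, h₂⟩
  have : IsIso ((R Q).map φ) :=
    inferInstanceAs (IsIso ((sheafToPresheaf (eltsTopology J Q) (Type w)).map ψ))
  have : (R Q).ReflectsIsomorphisms :=
    inferInstanceAs (overEquivElts Q).functor.ReflectsIsomorphisms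
  exact isIso_of_reflects_iso φ (R Q)

/-- `a_P` is left adjoint to `i_P`. -/
def sliceAdjunction (P : Cᵒᵖ ⥤ Type w) : sliceSheafify J P ⊣ sliceInclusion J P :=
  Over.postAdjunctionLeft (sheafificationAdjunction J (Type w))

/-- Sheafification preserves this pullback and inverts the unit, and a base change of an isomorphism
is an isomorphism. -/
lemma isIso_sheafify_fst {F : Cᵒᵖ ⥤ Type w}
    (k : F ⟶ ((presheafToSheaf J (Type w)).obj P).obj) :
    IsIso ((presheafToSheaf J (Type w)).map
      (pullback.fst k ((sheafificationAdjunction J (Type w)).unit.app P))) := by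
  have : IsIso ((presheafToSheaf J (Type w)).map
      ((sheafificationAdjunction J (Type w)).unit.app P)) := by
    rw [← GrothendieckTopology.W_iff]
    exact J.W_toSheafify P
  exact ((IsPullback.of_hasPullback k _).map (presheafToSheaf J (Type w))).isIso_fst_of_isIso

instance isIso_sliceAdjunction_counit (P : Cᵒᵖ ⥤ Type w) :
    IsIso (sliceAdjunction J P).counit := by
  rw [NatTrans.isIso_iff_isIso_app]
  intro k
  have := isIso_sheafify_fst (P := P) J k.hom.hom
  have h : ((sliceAdjunction J P).counit.app k).left =
      (presheafToSheaf J (Type w)).map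
        (pullback.fst k.hom.hom ((sheafificationAdjunction J (Type w)).unit.app P)) ≫
      (sheafificationAdjunction J (Type w)).counit.app k.left := by
    simp [sliceAdjunction]
    rfl
  have : IsIso ((Over.forget _).map ((sliceAdjunction J P).counit.app k)) := by
    change IsIso ((sliceAdjunction J P).counit.app k).left
    rw [h]
    exact IsIso.comp_isIso' this inferInstance
  exact isIso_of_reflects_iso _ (Over.forget _)

/-- The inclusion `i_P` is fully faithful. -/
def sliceInclusionFullyFaithful (P : Cᵒᵖ ⥤ Type w) : (sliceInclusion J P).FullyFaithful :=
  (sliceAdjunction J P).fullyFaithfulROfIsIsoCounit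

lemma R_sliceInclusion_isSheaf (k : Over ((presheafToSheaf J (Type w)).obj P)) :
    Presheaf.IsSheaf (eltsTopology J P) ((R P).obj ((sliceInclusion J P).obj k)) :=
  ((RSheaf J P).obj k).property

lemma isIso_sliceAdjunction_unit (X : Over P)
    (hX : Presheaf.IsSheaf (eltsTopology J P) ((R P).obj X)) :
    IsIso ((sliceAdjunction J P).unit.app X) := by
  refine isIso_of_W J _ ?_ hX (R_sliceInclusion_isSheaf J _)
  -- By the triangle identity this map is a section of a counit component, which is invertible.
  have h : IsIso ((sliceSheafify J P).map ((sliceAdjunction J P).unit.app X)) :=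
    isIso_of_comp_hom_eq_id _ ((sliceAdjunction J P).left_triangle_components X)
  exact (J.W_iff _).2 (inferInstanceAs (IsIso ((Over.forget _).map
    ((sliceSheafify J P).map ((sliceAdjunction J P).unit.app X)))))

/-- The inclusions `i` commute with pullback. -/
def sliceInclusionCompPullback (f : P ⟶ Q) :
    sliceInclusion J Q ⋙ Over.pullback f ≅
      Over.pullback ((presheafToSheaf J (Type w)).map f) ⋙ sliceInclusion J P :=
  -- Both sides are right adjoints. Their left adjoints compose with `f` and sheafify, in the two
  -- orders, and agree by functoriality of sheafification.
  conjugateIsoEquiv ((Over.mapPullbackAdj f).comp (sliceAdjunction J Q))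
    ((sliceAdjunction J P).comp (Over.mapPullbackAdj _))
    (NatIso.ofComponents fun X => Over.isoMk (Iso.refl _)
      ((Category.id_comp _).trans ((presheafToSheaf J (Type w)).map_comp X.hom f)))

/-- As `R_Q ∘ L_Q` is the identity up to isomorphism, this presheaf is the Kan extension of a sheaf
along a comorphism of sites. -/
lemma R_ranProd_isSheaf (f : P ⟶ Q) (X : Over P)
    (hX : Presheaf.IsSheaf (eltsTopology J P) ((R P).obj X)) :
    Presheaf.IsSheaf (eltsTopology J Q) ((R Q).obj ((ranProd f).obj X)) :=
  (Presheaf.isSheaf_of_iso_iff ((isoRL Q).app ((eltsMap f).op.ran.obj ((R P).obj X)))).2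
    ((directImage J f).obj ⟨(R P).obj X, hX⟩).property

/-- `a_Q ∘ L_Q ∘ ran_{(∫ f)ᵒᵖ} ∘ R_P ∘ i_P` is a dependent product along `a(f)`. -/
def sheafRanProdAdjunction (f : P ⟶ Q) :
    Over.pullback ((presheafToSheaf J (Type w)).map f) ⊣
      sliceInclusion J P ⋙ ranProd f ⋙ sliceSheafify J Q :=
  -- Invertibility of this unit places the presheaf product in the essential image of `i_Q`, which
  -- allows the adjunction to be restricted.
  have (k : Over ((presheafToSheaf J (Type w)).obj P)) :
      IsIso ((sliceAdjunction J Q).unit.app ((ranProd f).obj ((sliceInclusion J P).obj k))) :=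
    isIso_sliceAdjunction_unit J _ (R_ranProd_isSheaf J f _ (R_sliceInclusion_isSheaf J k))
  (ranProdAdjunction f).restrictFullyFaithful (sliceInclusionFullyFaithful J Q)
    (sliceInclusionFullyFaithful J P) (sliceInclusionCompPullback J f)
    (NatIso.ofComponents (fun k => asIso ((sliceAdjunction J Q).unit.app
      ((ranProd f).obj ((sliceInclusion J P).obj k))))
      (fun _ => (sliceAdjunction J Q).unit.naturality _))

end

/-! ### Explicit description and the case of sheaves -/

section

variable {C : Type u} [Category.{v} C]

lemma R_post_isSheaf {J : GrothendieckTopology C}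
    {P : Sheaf J (Type w)} (h : Over P) :
    Presheaf.IsSheaf (eltsTopology J P.obj)
      ((R P.obj).obj ((Over.post (sheafToPresheaf J (Type w))).obj h)) :=
  fiberPresheaf_isSheaf J (h := (Over.post (sheafToPresheaf J (Type w))).obj h) (W := h.left) (S := P)
    h.hom.hom (𝟙 _) (𝟙 _) (IsPullback.id_horiz h.hom.hom)

variable [EssentiallySmall.{w} C]

section Explicit

variable {P Q : Cᵒᵖ ⥤ Type w} (f : P ⟶ Q)

/-- The component at `(X, q) ⟵ (Y, f_Y(p))` of an element of a right Kan extension along `∫ f`. -/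
def ranComponent (W : (Elts P)ᵒᵖ ⥤ Type w) {X Y : Cᵒᵖ} {q : Q.obj X}
    (t : ((eltsMap f).op.ran.obj W).obj (op (Elts.mk q))) (g : X ⟶ Y) (p : P.obj Y)
    (hp : f.app Y p = Q.map g q) : W.obj (op (Elts.mk p)) :=
  ((eltsMap f).op.ranCounit.app W).app (op (Elts.mk p))
    (((eltsMap f).op.ran.obj W).map (Elts.homMk (P := Q) g q (f.app Y p) hp.symm).op t)

variable {f} in
lemma map_ranComponent (W : (Elts P)ᵒᵖ ⥤ Type w) {X Y Z : Cᵒᵖ} {q : Q.obj X}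
    (t : ((eltsMap f).op.ran.obj W).obj (op (Elts.mk q))) (g : X ⟶ Y) (p : P.obj Y)
    (hp : f.app Y p = Q.map g q) (γ : Y ⟶ Z) (p' : P.obj Z) (hγ : P.map γ p = p')
    (hp' : f.app Z p' = Q.map (g ≫ γ) q) :
    W.map (Elts.homMk (P := P) γ p p' hγ).op (ranComponent f W t g p hp) =
      ranComponent f W t (g ≫ γ) p' hp' := by
  refine (NatTrans.naturality_apply ((eltsMap f).op.ranCounit.app W) _ _).symm.trans ?_
  refine congrArg _ ?_
  exact (Functor.map_comp_apply ((eltsMap f).op.ran.obj W) _ _ t).symm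

variable {f} in
lemma ranComponent_map (W : (Elts P)ᵒᵖ ⥤ Type w) {X X' Y : Cᵒᵖ} {q : Q.obj X}
    (t : ((eltsMap f).op.ran.obj W).obj (op (Elts.mk q))) (k : X ⟶ X') (q' : Q.obj X')
    (hk : Q.map k q = q') (g : X' ⟶ Y) (p : P.obj Y) (hp : f.app Y p = Q.map g q')
    (hp' : f.app Y p = Q.map (k ≫ g) q) :
    ranComponent f W (((eltsMap f).op.ran.obj W).map (Elts.homMk (P := Q) k q q' hk).op t) g p hp =
      ranComponent f W t (k ≫ g) p hp' :=
  congrArg _ (Functor.map_comp_apply ((eltsMap f).op.ran.obj W) _ _ t).symm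

variable {f} in
lemma ranComponent_naturality {W W' : (Elts P)ᵒᵖ ⥤ Type w} (φ : W ⟶ W') {X Y : Cᵒᵖ} {q : Q.obj X}
    (t : ((eltsMap f).op.ran.obj W).obj (op (Elts.mk q))) (g : X ⟶ Y) (p : P.obj Y)
    (hp : f.app Y p = Q.map g q) :
    ranComponent f W' (((eltsMap f).op.ran.map φ).app _ t) g p hp =
      φ.app _ (ranComponent f W t g p hp) := by
  refine (congrArg _ (NatTrans.naturality_apply ((eltsMap f).op.ran.map φ) _ t).symm).trans ?_
  exact ConcreteCategory.congr_hom (NatTrans.congr_app ((eltsMap f).op.ranCounit.naturality φ)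
    (op (Elts.mk p))) _

-- The value of `ran` at `(X, q)` is a limit over the arrows of `∫ Q` from some `(Y, f(p))` to `(X,
-- q)`. Such arrows are exactly the index pairs `(g, p)`, so the components determine the element.
variable {f} in
lemma ran_ext (W : (Elts P)ᵒᵖ ⥤ Type w) {X : Cᵒᵖ} {q : Q.obj X}
    {t t' : ((eltsMap f).op.ran.obj W).obj (op (Elts.mk q))}
    (h : ∀ (Y : Cᵒᵖ) (g : X ⟶ Y) (p : P.obj Y) (hp : f.app Y p = Q.map g q),
      ranComponent f W t g p hp = ranComponent f W t' g p hp) : t = t' := by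
  refine (Types.isLimitEquivSections
    ((eltsMap f).op.isPointwiseRightKanExtensionRanCounit W (op (Elts.mk q)))).injective
      (Subtype.ext (funext fun j => ?_))
  obtain ⟨⟨⟨⟩⟩, ⟨⟨Y, p⟩⟩, ⟨⟨g, hg⟩⟩⟩ := j
  exact h Y g p hg.symm

/-- The existence half of the same limit formula: the hypothesis on `x` says that the family is a
section of the limit diagram. -/
lemma exists_ran (W : (Elts P)ᵒᵖ ⥤ Type w) {X : Cᵒᵖ} {q : Q.obj X}
    (x : ∀ {Y : Cᵒᵖ} (g : X ⟶ Y) (p : P.obj Y), f.app Y p = Q.map g q → W.obj (op (Elts.mk p)))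
    (hx : ∀ {Y Z : Cᵒᵖ} (g : X ⟶ Y) (g' : X ⟶ Z) (p : P.obj Y) (p' : P.obj Z)
      (hp : f.app Y p = Q.map g q) (hp' : f.app Z p' = Q.map g' q) (γ : Y ⟶ Z)
      (_ : g' = g ≫ γ) (hγ : P.map γ p = p'),
      W.map (Elts.homMk (P := P) γ p p' hγ).op (x g p hp) = x g' p' hp') :
    ∃ t : ((eltsMap f).op.ran.obj W).obj (op (Elts.mk q)),
      ∀ (Y : Cᵒᵖ) (g : X ⟶ Y) (p : P.obj Y) (hp : f.app Y p = Q.map g q),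
        ranComponent f W t g p hp = x g p hp := by
  let e := Types.isLimitEquivSections
    ((eltsMap f).op.isPointwiseRightKanExtensionRanCounit W (op (Elts.mk q)))
  obtain ⟨t, ht⟩ := e.surjective ⟨fun j => x j.hom.unop.unop.1
    j.right.unop.unop.2 j.hom.unop.unop.2.symm, by
      rintro ⟨⟨⟨⟩⟩, ⟨⟨Y, p⟩⟩, ⟨⟨g, hg⟩⟩⟩ ⟨⟨⟨⟩⟩, ⟨⟨Z, p'⟩⟩, ⟨⟨g', hg'⟩⟩⟩ ⟨a, ⟨⟨γ, hγ⟩⟩, w⟩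
      -- The commuting triangle of a morphism of structured arrows, read in `C`.
      have hw : g' = g ≫ γ := by
        have := congrArg (fun k => k.unop.unop.1) w
        exact (Category.id_comp _).symm.trans this
      exact hx g g' p p' hg.symm hg'.symm γ hw hγ⟩
  refine ⟨t, fun Y g p hp => ?_⟩
  exact congrFun (congrArg Subtype.val ht) (StructuredArrow.mk (Y := op (Elts.mk p))
    (S := op (Elts.mk q)) (T := (eltsMap f).op) (Elts.homMk (P := Q) g q (f.app Y p) hp.symm).op)

/-- The compatible pair attached to an element of `L_Q (ran_{(∫ f)ᵒᵖ} (R_P [h]))`. -/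
def toCompatiblePair (h : Over P) (X : Cᵒᵖ) (s : ((ranProd f).obj h).left.obj X) :
    CompatiblePair f h X where
  base := s.1
  fam _ g p hp := ranComponent f ((R P).obj h) s.2 g.op p hp
  compat _ _ g γ p hp hp' :=
    congrArg Subtype.val (map_ranComponent ((R P).obj h) s.2 g.op p hp γ.op _ rfl hp')

lemma toCompatiblePair_bijective (h : Over P) (X : Cᵒᵖ) :
    Function.Bijective (toCompatiblePair f h X) := by
  constructor
  · rintro ⟨q, t⟩ ⟨q', t'⟩ hs
    obtain rfl : q = q' := congrArg CompatiblePair.base hs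
    refine congrArg (Sigma.mk q) (ran_ext ((R P).obj h) fun Y g p hp => ?_)
    have hs' := eq_of_heq (CompatiblePair.mk.inj hs).2
    exact congrFun (congrFun (congrFun (congrFun hs' _) g.unop) p) hp
  · rintro ⟨q, x, hx⟩
    obtain ⟨t, ht⟩ := exists_ran f ((R P).obj h) (X := X) (q := q)
      (fun g p hp => x _ g.unop p hp) (by
        rintro Y Z g _ p _ hp hp' γ rfl rfl
        exact Subtype.ext (hx Y.unop Z.unop g.unop γ.unop p hp hp'))
    refine ⟨⟨q, t⟩, CompatiblePair.ext rfl (heq_of_eq ?_)⟩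
    funext Y g p hp
    exact ht (op Y) g.op p hp

/-- Elements of the dependent product of presheaves are compatible pairs. -/
def ranProdEquiv (h : Over P) (X : Cᵒᵖ) :
    ((ranProd f).obj h).left.obj X ≃ CompatiblePair f h X :=
  Equiv.ofBijective _ (toCompatiblePair_bijective f h X)

lemma ranProdEquiv_map (h : Over P) {X X' : Cᵒᵖ} (k : X ⟶ X')
    (s : ((ranProd f).obj h).left.obj X) :
    ranProdEquiv f h X' (((ranProd f).obj h).left.map k s) =
      (ranProdEquiv f h X s).restrict k := by
  refine CompatiblePair.ext rfl (heq_of_eq ?_)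
  funext Y g p hp
  exact ranComponent_map ((R P).obj h) s.2 k _ rfl g.op p hp
    (hp.trans (Functor.map_comp_apply Q k g.op s.1).symm)

lemma ranProdEquiv_naturality {h h' : Over P} (φ : h ⟶ h') (X : Cᵒᵖ)
    (s : ((ranProd f).obj h).left.obj X) :
    ranProdEquiv f h' X (((ranProd f).map φ).left.app X s) = (ranProdEquiv f h X s).map φ := by
  refine CompatiblePair.ext rfl (heq_of_eq ?_)
  funext Y g p hp
  exact ranComponent_naturality ((R P).map φ) s.2 g.op p hp

/-- Elements of a presheaf over `Q` isomorphic to the dependent product are compatible pairs. -/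
def compatiblePairEquiv {h : Over P} {K : Over Q} (γ : K ≅ (ranProd f).obj h) (X : Cᵒᵖ) :
    K.left.obj X ≃ CompatiblePair f h X :=
  (((Over.forget _).mapIso γ).app X).toEquiv.trans (ranProdEquiv f h X)

lemma compatiblePairEquiv_base {h : Over P} {K : Over Q} (γ : K ≅ (ranProd f).obj h) (X : Cᵒᵖ)
    (s : K.left.obj X) : (compatiblePairEquiv f γ X s).base = K.hom.app X s := by
  have h := ConcreteCategory.congr_hom (NatTrans.congr_app (Over.w γ.hom) X) s
  exact h

lemma compatiblePairEquiv_map {h : Over P} {K : Over Q} (γ : K ≅ (ranProd f).obj h) {X X' : Cᵒᵖ}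
    (k : X ⟶ X') (s : K.left.obj X) :
    compatiblePairEquiv f γ X' (K.left.map k s) = (compatiblePairEquiv f γ X s).restrict k :=
  (congrArg (ranProdEquiv f h X') (NatTrans.naturality_apply γ.hom.left k s)).trans
    (ranProdEquiv_map f h k _)

lemma compatiblePairEquiv_naturality {h h' : Over P} {K K' : Over Q}
    (γ : K ≅ (ranProd f).obj h) (γ' : K' ≅ (ranProd f).obj h') (φ : h ⟶ h') (ψ : K ⟶ K')
    (w : ψ ≫ γ'.hom = γ.hom ≫ (ranProd f).map φ) (X : Cᵒᵖ) (s : K.left.obj X) :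
    compatiblePairEquiv f γ' X (ψ.left.app X s) = (compatiblePairEquiv f γ X s).map φ :=
  (congrArg (ranProdEquiv f h' X) (ConcreteCategory.congr_hom
    (NatTrans.congr_app (congrArg Over.Hom.left w) X) s)).trans (ranProdEquiv_naturality f φ X _)

end Explicit

section Sheaf

variable {J : GrothendieckTopology C}

/-- The inclusion `Sh(C, J)/P ⥤ [Cᵒᵖ, Set]/P` for a sheaf `P`. -/
abbrev overInclusion (P : Sheaf J (Type w)) : Over P ⥤ Over P.obj :=
  Over.post (sheafToPresheaf J (Type w))

/-- The inclusion `Sh(C, J)/P ⥤ [Cᵒᵖ, Set]/P` is fully faithful. -/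
def overInclusionFullyFaithful (P : Sheaf J (Type w)) : (overInclusion P).FullyFaithful :=
  (fullyFaithfulSheafToPresheaf J (Type w)).over P

/-- A presheaf over a sheaf `Q` is a sheaf if it corresponds to a sheaf on `∫ Q`. -/
lemma isSheaf_left {Q : Sheaf J (Type w)} (X : Over Q.obj)
    (hX : Presheaf.IsSheaf (eltsTopology J Q.obj) ((R Q.obj).obj X)) :
    Presheaf.IsSheaf J X.left := by
  have := isIso_sliceAdjunction_unit J X hX
  have : IsIso ((sheafificationAdjunction J (Type w)).unit.app Q.obj) :=
    isIso_toSheafify J Q.property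
  -- Since `Q` is a sheaf, its unit is invertible, and so is the projection from the pullback along
  -- it. Thus `X.left` is isomorphic to its own sheafification.
  have := (IsPullback.of_hasPullback ((presheafToSheaf J (Type w)).map X.hom).hom
    ((sheafificationAdjunction J (Type w)).unit.app Q.obj)).isIso_fst_of_isIso
  exact (Presheaf.isSheaf_of_iso_iff
    ((Over.forget _).mapIso (asIso ((sliceAdjunction J Q.obj).unit.app X)) ≪≫
      @asIso _ _ _ _ (pullback.fst ((presheafToSheaf J (Type w)).map X.hom).hom
        ((sheafificationAdjunction J (Type w)).unit.app Q.obj)) this)).2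
    ((presheafToSheaf J (Type w)).obj X.left).property

variable {P Q : Sheaf J (Type w)} (f : P ⟶ Q)

/-- The inclusion of sheaves in presheaves commutes with pullback. -/
def overInclusionCompPullback :
    overInclusion Q ⋙ Over.pullback f.hom ≅ Over.pullback f ⋙ overInclusion P :=
  NatIso.ofComponents (fun h => Over.isoMk
    ((IsPullback.of_hasPullback h.hom f).map (sheafToPresheaf J (Type w))).isoPullback.symm
      (IsPullback.isoPullback_inv_snd _))
    (by
      intro h h' φ
      refine Over.OverMorphism.ext ?_
      refine ((IsPullback.of_hasPullback h'.hom f).map (sheafToPresheaf J (Type w))).hom_ext ?_ ?_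
      · have e₁ : ((Over.pullback f.hom).map ((overInclusion Q).map φ)).left ≫
            pullback.fst h'.hom.hom f.hom = pullback.fst h.hom.hom f.hom ≫ φ.left.hom :=
          pullback.lift_fst _ _ _
        have e₂ : ((Over.pullback f).map φ).left ≫ pullback.fst h'.hom f =
            pullback.fst h.hom f ≫ φ.left := pullback.lift_fst _ _ _
        refine (Category.assoc _ _ _).trans ?_
        refine (congrArg (((Over.pullback f.hom).map ((overInclusion Q).map φ)).left ≫ ·)
          (IsPullback.isoPullback_inv_fst _)).trans (e₁.trans ?_)
        refine Eq.trans ?_ (Category.assoc _ _ _).symm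
        refine Eq.trans ?_ (congrArg (((IsPullback.of_hasPullback h.hom f).map
          (sheafToPresheaf J (Type w))).isoPullback.inv ≫ ·) (congrArg (·.hom) e₂).symm)
        refine Eq.trans ?_ (Category.assoc _ _ _)
        exact congrArg (· ≫ φ.left.hom) (IsPullback.isoPullback_inv_fst _).symm
      -- The second projection is the structural morphism to `P`, which every morphism over `P`
      -- respects.
      · exact (Over.w (_ : _ ⟶ (Over.pullback f ⋙ overInclusion P).obj h')).trans
          (Over.w (_ : _ ⟶ (Over.pullback f ⋙ overInclusion P).obj h')).symm)

/-- The dependent product of sheaves, constructed as that of presheaves. -/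
def sheafProd : Over P ⥤ Over Q where
  obj h := Over.mk (Y := (⟨_, isSheaf_left _ (R_ranProd_isSheaf J f.hom _
    (R_post_isSheaf h))⟩ : Sheaf J (Type w)))
      ⟨((ranProd f.hom).obj ((overInclusion P).obj h)).hom⟩
  map φ := Over.homMk ⟨((ranProd f.hom).map ((overInclusion P).map φ)).left⟩
    (Sheaf.hom_ext (Over.w ((ranProd f.hom).map ((overInclusion P).map φ))))
  map_id h := Over.OverMorphism.ext (Sheaf.hom_ext
    (congrArg Over.Hom.left ((overInclusion P ⋙ ranProd f.hom).map_id h)))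
  map_comp φ ψ := Over.OverMorphism.ext (Sheaf.hom_ext
    (congrArg Over.Hom.left ((overInclusion P ⋙ ranProd f.hom).map_comp φ ψ)))

/-- The dependent product of sheaves has the dependent product of presheaves as underlying
presheaf. -/
def sheafProdCompOverInclusion :
    sheafProd f ⋙ overInclusion Q ≅ overInclusion P ⋙ ranProd f.hom :=
  NatIso.ofComponents (fun _ => Over.isoMk (Iso.refl _) (Category.id_comp _))
    (fun _ => Over.OverMorphism.ext ((Category.comp_id _).trans (Category.id_comp _).symm))

/-- `sheafProd f` is right adjoint to the pullback functor along `f`. -/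
def sheafProdAdjunction : Over.pullback f ⊣ sheafProd f :=
  (ranProdAdjunction f.hom).restrictFullyFaithful (overInclusionFullyFaithful Q)
    (overInclusionFullyFaithful P) (overInclusionCompPullback f)
    (sheafProdCompOverInclusion f).symm

end Sheaf

end

end DepProd

end

theorem mainTheorem3 {C : Type u} [Category.{v} C] [EssentiallySmall.{w} C]
    (J : GrothendieckTopology C) :
    -- the general formula, for a morphism `f : P ⟶ Q` of presheaves
    (∀ {P Q : Cᵒᵖ ⥤ Type w} (f : P ⟶ Q),
      (∃ prodSh, DepProd.IsDependentProduct ((presheafToSheaf J (Type w)).map f) prodSh) ∧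
      (∃ prodPr, DepProd.IsDependentProduct f prodPr) ∧
      ∀ (prodSh : Over ((presheafToSheaf J (Type w)).obj P) ⥤
            Over ((presheafToSheaf J (Type w)).obj Q))
        (prodPr : Over P ⥤ Over Q),
        DepProd.IsDependentProduct ((presheafToSheaf J (Type w)).map f) prodSh →
        DepProd.IsDependentProduct f prodPr →
        Nonempty (prodSh ≅
          DepProd.RSheaf J P ⋙ DepProd.directImage J f ⋙ DepProd.LSheaf J Q) ∧
        Nonempty (DepProd.RSheaf J P ⋙ DepProd.directImage J f ⋙ DepProd.LSheaf J Q ≅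
          DepProd.sliceInclusion J P ⋙ DepProd.R P ⋙ (DepProd.eltsMap f).op.ran ⋙
            DepProd.L Q ⋙ DepProd.sliceSheafify J Q) ∧
        Nonempty (DepProd.sliceInclusion J P ⋙ DepProd.R P ⋙ (DepProd.eltsMap f).op.ran ⋙
            DepProd.L Q ⋙ DepProd.sliceSheafify J Q ≅
          DepProd.sliceInclusion J P ⋙ prodPr ⋙ DepProd.sliceSheafify J Q)) ∧
    -- the explicit description, for a morphism `f : P ⟶ Q` of sheaves
    (∀ {P Q : Sheaf J (Type w)} (f : P ⟶ Q),
      (∃ prodSh, DepProd.IsDependentProduct f prodSh) ∧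
      ∀ prodSh : Over P ⥤ Over Q, DepProd.IsDependentProduct f prodSh →
        (∃ e : ∀ (h : Over P) (X : Cᵒᵖ), (prodSh.obj h).left.obj.obj X ≃
            DepProd.CompatiblePair f.hom ((Over.post (sheafToPresheaf J (Type w))).obj h) X,
          -- compatible with the projections to `Q`
          (∀ h X s, (e h X s).base = (prodSh.obj h).hom.hom.app X s) ∧
          -- natural in `X`
          (∀ h X X' (k : X ⟶ X') s, e h X' ((prodSh.obj h).left.obj.map k s) =
            (e h X s).restrict k) ∧
          -- natural in `h`
          (∀ h h' (φ : h ⟶ h') X s, e h' X ((prodSh.map φ).left.hom.app X s) =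
            (e h X s).map ((Over.post (sheafToPresheaf J (Type w))).map φ))) ∧
        -- independence of `J`: the dependent product of sheaves is that of presheaves
        (∀ prodPr : Over P.obj ⥤ Over Q.obj, DepProd.IsDependentProduct f.hom prodPr →
          Nonempty (prodSh ⋙ Over.post (sheafToPresheaf J (Type w)) ≅
            Over.post (sheafToPresheaf J (Type w)) ⋙ prodPr))) := by
  refine ⟨fun {P Q} f => ⟨⟨_, ⟨DepProd.sheafRanProdAdjunction J f⟩⟩,
    ⟨_, ⟨DepProd.ranProdAdjunction f⟩⟩, ?_⟩,
    fun {P Q} f => ⟨⟨_, ⟨DepProd.sheafProdAdjunction f⟩⟩, ?_⟩⟩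
  · rintro prodSh prodPr ⟨adjSh⟩ ⟨adjPr⟩
    -- The middle isomorphism is an identity: `RSheaf`, `directImage` and `LSheaf` unfold to the
    -- same composite once the sheaf conditions are forgotten.
    exact ⟨⟨adjSh.rightAdjointUniq (DepProd.sheafRanProdAdjunction J f)⟩, ⟨Iso.refl _⟩,
      ⟨Functor.isoWhiskerLeft (DepProd.sliceInclusion J P) (Functor.isoWhiskerRight
        ((DepProd.ranProdAdjunction f).rightAdjointUniq adjPr) (DepProd.sliceSheafify J Q))⟩⟩
  · rintro prodSh ⟨adjSh⟩
    -- This comparison carries the whole explicit part: its components give the bijections, its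
    -- naturality gives naturality in `h`, and uniqueness of adjoints turns it into independence of
    -- `J`.
    let β : prodSh ⋙ DepProd.overInclusion Q ≅
        DepProd.overInclusion P ⋙ DepProd.ranProd f.hom :=
      Functor.isoWhiskerRight (adjSh.rightAdjointUniq (DepProd.sheafProdAdjunction f)) _ ≪≫
        DepProd.sheafProdCompOverInclusion f
    exact ⟨⟨fun h X => DepProd.compatiblePairEquiv f.hom (β.app h) X,
      fun h X s => DepProd.compatiblePairEquiv_base f.hom (β.app h) X s,
      fun h X X' k s => DepProd.compatiblePairEquiv_map f.hom (β.app h) k s,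
      fun h h' φ X s => DepProd.compatiblePairEquiv_naturality f.hom (β.app h) (β.app h')
        ((Over.post (sheafToPresheaf J (Type w))).map φ) _ (β.hom.naturality φ) X s⟩,
      fun prodPr ⟨adjPr⟩ => ⟨β ≪≫ Functor.isoWhiskerLeft _
        ((DepProd.ranProdAdjunction f.hom).rightAdjointUniq adjPr)⟩⟩
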